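/- Let $(K,v)$ be a valued field (of arbitrary rank, valuations written additively), with completion $(\widehat K,v)$. Fix an extension of $v$ from $\widehat K$ to an algebraic closure $\overline{\widehat K}$ of $\widehat K$, let $\overline K\subseteq\overline{\widehat K}$ be the algebraic closure of $K$ with the restricted valuation, and fix an extension of this valuation to the rational function field $\overline K(X)$; write $v$ for all these valuations. Assume that $(K(X)|K,v)$ is valuation transcendental, i.e. $\dim_{\mathbb Q}\bigl(\mathbb Q\otimes_{\mathbb Z} vK(X)/vK\bigr)=1$ or $\operatorname{trdeg}[K(X)v:Kv]=1$, and that the value group $vK$ is cofinal in $vK(X)$. For a valued field $(E,v)$, $a\in E$ and $\gamma$ in an ordered abelian group containing $vE$, let $v_{a,\gamma}$ be the valuation on $E(X)$ with $v_{a,\gamma}\bigl(\sum_i C_i(X-a)^i\bigr)=\min_i\,(vC_i+i\gamma)$. Let $F=K$ or $F=\widehat K$. For a valuation $v$ on $\overline F(X)$, a pair $(a,\gamma)$ with $a\in\overline F$ and $\gamma\in v\overline F(X)$ is a pair of definition for $v$ over $F$ if $v=v_{a,\gamma}$ on $\overline F(X)$; it is a minimal pair of definition for $v$ over $F$ if moreover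 $[F(a):F]\le[F(b):F]$ for all $b\in\overline F$ with $v(a-b)\ge\gamma$. The valuation on $\overline{\widehat K}(X)$ is taken to be $v_{b,\delta}$, where $(b,\delta)$ is any pair of definition for $v$ over $K$, and the induced extension $(\widehat K(X)|\widehat K,v)$ is obtained by restricting it to $\widehat K(X)$. Let $(a,\gamma)$ be a minimal pair of definition for $v$ over $K$. Then $(a,\gamma)$ is also a minimal pair of definition for the induced extension $(\widehat K(X)|\widehat K,v)$, i.e. for the valuation on $\overline{\widehat K}(X)$ over $\widehat K$. Further, $$[K(a):K]=[\widehat K(a):\widehat K],$$ and the extension $(\widehat K(X)|K(X),v)$ is immediate, i.e. $v\widehat K(X)=vK(X)$ and $\widehat K(X)v=K(X)v$. -/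

import Mathlib

open Polynomial IntermediateField

/-!
Valuations are written multiplicatively, as in Mathlib: an additive inequality `v a ≥ γ` reads
`v a ≤ γ`, a minimum of values becomes a maximum, `i γ` becomes `γ ^ i`, and the value `∞` of `0`
is `0 : Γ₀`.  Elements of ordered groups of values are units of `Γ₀`.
-/

namespace RatFuncValuation

section Monomial

variable {E : Type*} [Field E] {Γ₀ : Type*} [LinearOrderedCommGroupWithZero Γ₀]

/-- The map `∑ cᵢ Xⁱ ↦ min (u cᵢ + i γ)` on polynomials (multiplicatively, a maximum). -/
noncomputable def gaussFun (u : Valuation E Γ₀) (γ : Γ₀ˣ) (f : E[X]) : Γ₀ :=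
  f.support.sup fun i => u (f.coeff i) * (γ : Γ₀) ^ i

lemma term_le_gaussFun (u : Valuation E Γ₀) (γ : Γ₀ˣ) (f : E[X]) (i : ℕ) :
    u (f.coeff i) * (γ : Γ₀) ^ i ≤ gaussFun u γ f := by
  by_cases hi : i ∈ f.support
  · exact Finset.le_sup (f := fun i => u (f.coeff i) * (γ : Γ₀) ^ i) hi
  · rw [Polynomial.notMem_support_iff.1 hi]
    simp

lemma gaussFun_le (u : Valuation E Γ₀) (γ : Γ₀ˣ) (f : E[X]) (c : Γ₀)
    (h : ∀ i, u (f.coeff i) * (γ : Γ₀) ^ i ≤ c) : gaussFun u γ f ≤ c :=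
  Finset.sup_le fun i _ => h i

lemma gaussFun_zero (u : Valuation E Γ₀) (γ : Γ₀ˣ) : gaussFun u γ 0 = 0 :=
  le_antisymm (gaussFun_le u γ 0 0 fun i => by simp) zero_le

lemma gaussFun_ne_zero (u : Valuation E Γ₀) (γ : Γ₀ˣ) {f : E[X]} (hf : f ≠ 0) :
    gaussFun u γ f ≠ 0 := by
  intro h
  have h1 := term_le_gaussFun u γ f f.natDegree
  rw [h] at h1
  have h2 := le_antisymm h1 zero_le
  simp [hf] at h2

lemma exists_min_term (u : Valuation E Γ₀) (γ : Γ₀ˣ) {f : E[X]} (hf : f ≠ 0) :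
    ∃ i, u (f.coeff i) * (γ : Γ₀) ^ i = gaussFun u γ f ∧
      ∀ k < i, u (f.coeff k) * (γ : Γ₀) ^ k < gaussFun u γ f := by
  classical
  have hex : ∃ i, u (f.coeff i) * (γ : Γ₀) ^ i = gaussFun u γ f := by
    obtain ⟨i, -, hi⟩ := Finset.exists_mem_eq_sup f.support
      (Polynomial.support_nonempty.2 hf) (fun i => u (f.coeff i) * (γ : Γ₀) ^ i)
    exact ⟨i, hi.symm⟩
  exact ⟨Nat.find hex, Nat.find_spec hex, fun k hk =>
    lt_of_le_of_ne (term_le_gaussFun u γ f k) (Nat.find_min hex hk)⟩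

lemma gaussFun_mul (u : Valuation E Γ₀) (γ : Γ₀ˣ) (f g : E[X]) :
    gaussFun u γ (f * g) = gaussFun u γ f * gaussFun u γ g := by
  classical
  rcases eq_or_ne f 0 with rfl | hf
  · simp [gaussFun_zero]
  rcases eq_or_ne g 0 with rfl | hg
  · simp [gaussFun_zero]
  have hγ : ∀ n : ℕ, (γ : Γ₀) ^ n ≠ 0 := fun n => pow_ne_zero n γ.ne_zero
  have key : ∀ k l : ℕ, u (f.coeff k * g.coeff l) * (γ : Γ₀) ^ (k + l) =
      (u (f.coeff k) * (γ : Γ₀) ^ k) * (u (g.coeff l) * (γ : Γ₀) ^ l) := by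
    intro k l
    rw [map_mul, pow_add]
    exact mul_mul_mul_comm _ _ _ _
  refine le_antisymm (gaussFun_le u γ _ _ fun n => ?_) ?_
  · rw [Polynomial.coeff_mul, ← le_div_iff₀ (zero_lt_iff.2 (hγ n))]
    refine u.map_sum_le fun p hp => ?_
    rw [le_div_iff₀ (zero_lt_iff.2 (hγ n)), ← Finset.HasAntidiagonal.mem_antidiagonal.1 hp, key]
    exact mul_le_mul' (term_le_gaussFun u γ f p.1) (term_le_gaussFun u γ g p.2)
  · obtain ⟨i, hi, hi'⟩ := exists_min_term u γ hf
    obtain ⟨j, hj, hj'⟩ := exists_min_term u γ hg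
    have hF := zero_lt_iff.2 (gaussFun_ne_zero u γ hf)
    have hG := zero_lt_iff.2 (gaussFun_ne_zero u γ hg)
    have hsum : u ((f * g).coeff (i + j)) = u (f.coeff i * g.coeff j) := by
      rw [Polynomial.coeff_mul]
      refine u.map_sum_eq_of_lt (f := fun p : ℕ × ℕ => f.coeff p.1 * g.coeff p.2)
        (j := (i, j)) (by simp) fun p hp => ?_
      rw [Finset.mem_sdiff, Finset.HasAntidiagonal.mem_antidiagonal, Finset.mem_singleton] at hp
      obtain ⟨hp, hne⟩ := hp
      rw [← mul_lt_mul_iff_left₀ (zero_lt_iff.2 (hγ (i + j))), key i j, ← hp, key, hi, hj]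
      rcases lt_or_ge p.1 i with h | h
      · exact mul_lt_mul_of_lt_of_le_of_nonneg_of_pos (hi' _ h) (term_le_gaussFun u γ g p.2)
          zero_le hG
      · have h2 : p.2 < j := by
          by_contra h3
          exact hne (Prod.ext (by simp only; omega) (by simp only; omega))
        exact mul_lt_mul_of_le_of_lt_of_nonneg_of_pos (term_le_gaussFun u γ f p.1) (hj' _ h2)
          zero_le hF
    rw [← hi, ← hj, ← key, ← hsum]
    exact term_le_gaussFun u γ _ _

/-- The valuation `∑ cᵢ Xⁱ ↦ min (u cᵢ + i γ)` of the polynomial ring. -/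
noncomputable def gaussValuation (u : Valuation E Γ₀) (γ : Γ₀ˣ) : Valuation E[X] Γ₀ where
  toFun := gaussFun u γ
  map_zero' := gaussFun_zero u γ
  map_one' := by
    refine le_antisymm (gaussFun_le u γ _ _ fun i => ?_) ?_
    · rw [Polynomial.coeff_one]
      split_ifs with h
      · subst h; simp
      · simp
    · simpa using term_le_gaussFun u γ (1 : E[X]) 0
  map_mul' := gaussFun_mul u γ
  map_add_le_max' f g := by
    refine gaussFun_le u γ _ _ fun i => ?_
    rw [Polynomial.coeff_add]
    rcases le_max_iff.1 (u.map_add_le_max' (f.coeff i) (g.coeff i)) with h | h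
    · exact le_max_of_le_left ((mul_le_mul_left h _).trans (term_le_gaussFun u γ f i))
    · exact le_max_of_le_right ((mul_le_mul_left h _).trans (term_le_gaussFun u γ g i))

/-- The valuation `u_{a,γ}` on `E[X]`: if `f = ∑ Cᵢ (X - a)ⁱ`, then
`u_{a,γ} f = min (u Cᵢ + i γ)`.  The `Cᵢ` are the coefficients of the Taylor expansion of `f`
at `a`. -/
noncomputable def monomialValuationPoly (u : Valuation E Γ₀) (a : E) (γ : Γ₀ˣ) :
    Valuation E[X] Γ₀ :=
  (gaussValuation u γ).comap (taylorAlgHom a).toRingHom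

lemma monomialValuationPoly_apply (u : Valuation E Γ₀) (a : E) (γ : Γ₀ˣ) (f : E[X]) :
    monomialValuationPoly u a γ f =
      (taylor a f).support.sup fun i => u ((taylor a f).coeff i) * (γ : Γ₀) ^ i := rfl

lemma nonZeroDivisors_le_primeCompl (u : Valuation E Γ₀) (a : E) (γ : Γ₀ˣ) :
    nonZeroDivisors E[X] ≤ (monomialValuationPoly u a γ).supp.primeCompl := by
  intro f hf h
  exact gaussFun_ne_zero u γ
    (mt (taylor_eq_zero a f).1 (nonZeroDivisors.ne_zero hf)) h

/-- The valuation `u_{a,γ}` on the rational function field `E(X)`. -/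
noncomputable def monomialValuation (u : Valuation E Γ₀) (a : E) (γ : Γ₀ˣ) :
    Valuation (RatFunc E) Γ₀ :=
  (monomialValuationPoly u a γ).extendToLocalization (nonZeroDivisors_le_primeCompl u a γ)
    (RatFunc E)

end Monomial

section Extensions

/-! An extension of valued fields `(N|M, W)` is given by a field homomorphism `i : M → N` and a
valuation `W` of `N`; the field `M` carries the restricted valuation `W.comap i`. -/

variable {M N : Type*} [Field M] [Field N] {Γ₀ : Type*} [LinearOrderedCommGroupWithZero Γ₀]

/-- The value group `WN = W(N^×)`. -/
def valueGroup (W : Valuation N Γ₀) : Subgroup Γ₀ˣ :=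
  MonoidWithZeroHom.valueGroup (.ofClass W)

/-- The inclusion of valuation rings `𝒪_M → 𝒪_N`. -/
def valuationRingMap (i : M →+* N) (W : Valuation N Γ₀) :
    (W.comap i).valuationSubring →+* W.valuationSubring :=
  (i.comp (W.comap i).valuationSubring.subtype).codRestrict W.valuationSubring fun x => x.2

instance isLocalHom_valuationRingMap (i : M →+* N) (W : Valuation N Γ₀) :
    IsLocalHom (valuationRingMap i W) where
  map_nonunit x hx := by
    have h1 : W (i x) = 1 :=
      (Valuation.integer.integers (v := W)).one_of_isUnit hx
    exact (Valuation.integer.integers (v := W.comap i)).isUnit_of_one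
      (isUnit_iff_ne_zero.2 fun h0 => by
        have : (x : M) = 0 := h0
        rw [this] at h1
        simp at h1) h1

/-- The residue field `NW`. -/
abbrev ResidueField (W : Valuation N Γ₀) : Type _ :=
  IsLocalRing.ResidueField W.valuationSubring

/-- The embedding of residue fields `MW → NW`. -/
noncomputable def residueFieldMap (i : M →+* N) (W : Valuation N Γ₀) :
    ResidueField (W.comap i) →+* ResidueField W :=
  IsLocalRing.ResidueField.map (valuationRingMap i W)

/-- The extension is immediate: same value group and same residue field. -/
def IsImmediate (i : M →+* N) (W : Valuation N Γ₀) : Prop :=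
  valueGroup (W.comap i) = valueGroup W ∧ Function.Surjective (residueFieldMap i W)

/-- The group `WM` is cofinal in `WN`: every element of `WN` is bounded from above (in additive
notation) by an element of `WM`. -/
def IsValueCofinal (i : M →+* N) (W : Valuation N Γ₀) : Prop :=
  ∀ α ∈ valueGroup W, ∃ β ∈ valueGroup (W.comap i), β ≤ α

/-- The rational rank of `WN / WM`, that is, the dimension of `ℚ ⊗ (WN / WM)`. -/
noncomputable def ratRank (i : M →+* N) (W : Valuation N Γ₀) : Cardinal :=
  Module.rank ℚ (TensorProduct ℤ ℚ
    (Additive (valueGroup W ⧸ (valueGroup (W.comap i)).subgroupOf (valueGroup W))))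

/-- The transcendence degree of the residue field extension `NW | MW`. -/
noncomputable def residueTrdeg (i : M →+* N) (W : Valuation N Γ₀) : Cardinal :=
  letI := (residueFieldMap i W).toAlgebra
  Algebra.trdeg (ResidueField (W.comap i)) (ResidueField W)

end Extensions

section RationalFunctions

variable (F : Type*) {E : Type*} [Field F] [Field E] [Algebra F E]
  {Γ₀ : Type*} [LinearOrderedCommGroupWithZero Γ₀]

variable (E) in
/-- The inclusion `F(X) → E(X)` for a field extension `E|F`. -/
noncomputable def ratFuncMap : RatFunc F →+* RatFunc E :=
  RatFunc.mapRingHom (Polynomial.mapRingHom (algebraMap F E))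
    (nonZeroDivisors_le_comap_nonZeroDivisors_of_injective _
      (Polynomial.map_injective _ (algebraMap F E).injective))

/-- The extension `(F(X)|F, W)` is valuation transcendental: it is value transcendental
or residue transcendental. -/
def IsValuationTranscendental (W : Valuation (RatFunc F) Γ₀) : Prop :=
  ratRank (RatFunc.C (K := F)) W = 1 ∨ residueTrdeg (RatFunc.C (K := F)) W = 1

/-- The pair `(a, γ)` is a pair of definition for `W`, a valuation on `E(X)` where `E` is
the algebraic closure of the base field: `W = u_{a,γ}`, where `u` is the restriction of `W` to `E`.
(This forces `γ = W (X - a)`, so that `γ` is in the value group of `W`.) -/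
def IsPairOfDefinition (W : Valuation (RatFunc E) Γ₀) (a : E) (γ : Γ₀ˣ) : Prop :=
  W = monomialValuation (W.comap RatFunc.C) a γ

/-- The pair `(a, γ)` is a minimal pair of definition for `W` over `F`, where `W` is a
valuation on `E(X)` and `E` is an algebraic closure of `F`. -/
def IsMinimalPairOfDefinition (W : Valuation (RatFunc E) Γ₀) (a : E) (γ : Γ₀ˣ) : Prop :=
  IsPairOfDefinition W a γ ∧
    ∀ b : E, W (RatFunc.C (a - b)) ≤ γ → Module.finrank F F⟮a⟯ ≤ Module.finrank F F⟮b⟯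

/-- For a field extension `L|E`, a valuation `w` of `E(X)` and a valuation `u` of `L` that agrees
with `w` on `E`: the valuation `W` of `L(X)` is `u_{b,δ}` for a pair of definition `(b, δ)` of `w`.
For `E` and `L` the algebraic closures of `K` and of its completion, this is the valuation whose
restriction to the rational function field over the completion is the extension induced by `w`. -/
def IsInduced {L : Type*} [Field L] [Algebra E L] (w : Valuation (RatFunc E) Γ₀)
    (u : Valuation L Γ₀) (W : Valuation (RatFunc L) Γ₀) : Prop :=
  ∃ (b : E) (δ : Γ₀ˣ), IsPairOfDefinition w b δ ∧ W = monomialValuation u (algebraMap E L b) δ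

end RationalFunctions

end RatFuncValuation

/-! The valuation on `L(X)` does not depend on the pair of definition used to induce it
(`IsInduced.eq_monomialValuation`), so it may be centred at `a`. The rest is approximation: `K` is
dense in its completion `H`, with precision measured by the values of `K`. Cofinality lets this
precision reach `γ`: since `X - a` is integral over `K(X)`, its value `γ` lies between two nonzero
values of `K` (`exists_bounds_X_sub_C`).

Given `c` in `L`, approximate its minimal polynomial over `H` by a monic `g` over `K` of the same
degree. Then `g` is small at `c`, so it has a root `r` near `c`, and `[K(r):K] ≤ [H(c):H]`
(`exists_finrank_le_and_valuation_sub_lt`). If `c` is within `γ` of `a`, so is `r`, and minimality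
over `K` gives `[K(a):K] ≤ [H(c):H]`. The case `c = a`, with the evident reverse inequality, gives
equality of degrees, and then minimality over `H`.

The bounds on `γ` also bound the value of a nonzero polynomial over `H` from below by a value of
`K`. Coefficientwise approximation thus reaches an error smaller than the polynomial itself. This
passes to quotients and yields immediacy (`isImmediate_monomialValuation`). -/

namespace RatFuncValuation

/-! ### Bounds for values of integral elements; a criterion for immediacy -/

section Bounds

variable {M N : Type*} [Field M] [Field N] {Γ₀ : Type*} [LinearOrderedCommGroupWithZero Γ₀]

lemma mem_valueGroup_iff_exists (W : Valuation N Γ₀) (α : Γ₀ˣ) :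
    α ∈ valueGroup W ↔ ∃ x : N, W x = α := by
  constructor
  · intro h
    have h1 : (α : Γ₀) ∈ Units.val '' (valueGroup W : Set Γ₀ˣ) := ⟨α, h, rfl⟩
    unfold valueGroup at h1
    rw [MonoidWithZeroHom.valueGroup_eq_range] at h1
    exact h1.1
  · rintro ⟨x, hx⟩
    exact MonoidWithZeroHom.mem_valueGroup _ ⟨x, hx⟩

/-- The values of integral elements are bounded by values from the base field. -/
lemma exists_valuation_le_of_isIntegral [Algebra M N] (u : Valuation N Γ₀) {y : N}
    (hy : IsIntegral M y) : ∃ k : M, k ≠ 0 ∧ u y ≤ u (algebraMap M N k) := by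
  rcases le_or_gt (u y) 1 with h1 | h1
  · exact ⟨1, one_ne_zero, by simpa using h1⟩
  obtain ⟨p, hp, hpy⟩ := hy
  -- If `u y > 1` exceeded every value from `M`, the top term of a monic equation for `y` would
  -- strictly dominate all the others and could not cancel.
  by_contra! hk
  have hy0 : u y ≠ 0 := (zero_lt_one.trans h1).ne'
  rw [eval₂_eq_sum_range, Finset.sum_range_succ, hp.coeff_natDegree, map_one, one_mul,
    add_comm] at hpy
  have h2 : u (y ^ p.natDegree) < u y ^ p.natDegree := by
    rw [eq_neg_of_add_eq_zero_left hpy, Valuation.map_neg]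
    refine u.map_sum_lt (pow_ne_zero _ hy0) fun i hi => ?_
    rw [Finset.mem_range] at hi
    rw [map_mul, map_pow]
    rcases eq_or_ne (p.coeff i) 0 with h0 | h0
    · rw [h0]
      simpa using zero_lt_iff.2 (pow_ne_zero _ hy0)
    · calc u (algebraMap M N (p.coeff i)) * u y ^ i < u y * u y ^ i :=
            mul_lt_mul_of_pos_right (hk _ h0) (zero_lt_iff.2 (pow_ne_zero _ hy0))
        _ = u y ^ (i + 1) := (pow_succ' _ _).symm
        _ ≤ u y ^ p.natDegree := pow_le_pow_right₀ h1.le hi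
  rw [map_pow] at h2
  exact h2.false

/-- The values of nonzero integral elements are bounded from below by values from the base
field. -/
lemma exists_le_valuation_of_isIntegral [Algebra M N] (u : Valuation N Γ₀) {y : N} (hy0 : y ≠ 0)
    (hy : IsIntegral M y) : ∃ k : M, k ≠ 0 ∧ u (algebraMap M N k) ≤ u y := by
  obtain ⟨k, hk, h⟩ := exists_valuation_le_of_isIntegral u hy.inv
  refine ⟨k⁻¹, inv_ne_zero hk, ?_⟩
  rw [map_inv₀] at h ⊢
  rw [map_inv₀]
  exact inv_le_of_inv_le₀ (zero_lt_iff.2 (u.ne_zero_iff.2 hy0)) h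

/-- If every element of `N` is approximated by an element of `M`, then the extension is
immediate. -/
lemma isImmediate_of_exists_sub_lt (i : M →+* N) (W : Valuation N Γ₀)
    (h : ∀ x : N, x ≠ 0 → ∃ y : M, W (x - i y) < W x) : IsImmediate i W := by
  have heq : ∀ {x y}, W (x - i y) < W x → W (i y) = W x := fun {x y} hxy => by
    rw [Valuation.map_sub_swap] at hxy
    exact Valuation.map_eq_of_sub_lt _ hxy
  constructor
  · ext α
    rw [mem_valueGroup_iff_exists, mem_valueGroup_iff_exists]
    constructor
    · rintro ⟨x, hx⟩
      exact ⟨i x, hx⟩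
    · rintro ⟨x, hx⟩
      obtain ⟨y, hy⟩ := h x (W.ne_zero_iff.1 (hx ▸ α.ne_zero))
      exact ⟨y, (heq hy).trans hx⟩
  · intro r
    obtain ⟨x, rfl⟩ := IsLocalRing.residue_surjective r
    rcases eq_or_ne (x : N) 0 with h0 | h0
    · refine ⟨0, ?_⟩
      have : x = 0 := Subtype.ext h0
      rw [this, map_zero, map_zero]
    obtain ⟨y, hy⟩ := h x h0
    have hx1 : W x ≤ 1 := x.2
    refine ⟨IsLocalRing.residue _ ⟨y, (heq hy).trans_le hx1⟩, ?_⟩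
    change IsLocalRing.residue _ (valuationRingMap i W ⟨y, _⟩) = _
    symm
    -- The difference has value less than 1, so it is not a unit and vanishes in the residue field.
    rw [← sub_eq_zero, ← map_sub, IsLocalRing.residue_eq_zero_iff, IsLocalRing.mem_maximalIdeal]
    intro hu
    have h1 : W (x - i y) = 1 := (Valuation.integer.integers (v := W)).one_of_isUnit hu
    exact (hy.trans_le hx1).ne h1

end Bounds

/-! ### Change of centre and uniqueness of pairs of definition -/

section Monomial

variable {E : Type*} [Field E] {Γ₀ : Type*} [LinearOrderedCommGroupWithZero Γ₀]

lemma gaussFun_C (u : Valuation E Γ₀) (γ : Γ₀ˣ) (x : E) : gaussFun u γ (C x) = u x := by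
  refine le_antisymm (gaussFun_le _ _ _ _ fun i => ?_) ?_
  · rw [coeff_C]
    split_ifs with h
    · simp [h]
    · simp
  · simpa using term_le_gaussFun u γ (C x) 0

lemma gaussFun_X_add_C (u : Valuation E Γ₀) (γ : Γ₀ˣ) (x : E) :
    gaussFun u γ (X + C x) = max (γ : Γ₀) (u x) := by
  refine le_antisymm (gaussFun_le _ _ _ _ fun i => ?_) (max_le ?_ ?_)
  · rcases i with _ | _ | i
    · simp
    · simp
    · simp [coeff_X]
  · have h := term_le_gaussFun u γ (X + C x) 1
    rwa [coeff_add, coeff_X_one, coeff_C_succ, add_zero, map_one, one_mul, pow_one] at h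
  · have h := term_le_gaussFun u γ (X + C x) 0
    rwa [coeff_add, coeff_X_zero, coeff_C_zero, zero_add, pow_zero, mul_one] at h

/-- The substitution `X ↦ X + c` sends `X` to an element whose value is still `γ`, so the
ultrametric inequality applies termwise. The reverse inequality comes from translating back by `-c`.
-/
lemma gaussFun_taylor_le (u : Valuation E Γ₀) (γ : Γ₀ˣ) {c : E} (hc : u c ≤ γ) (f : E[X]) :
    gaussFun u γ (taylor c f) ≤ gaussFun u γ f := by
  rw [taylor_apply, comp_eq_sum_left, sum_def]
  refine (gaussValuation u γ).map_sum_le fun i _ => ?_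
  rw [map_mul, map_pow]
  change gaussFun u γ (C _) * gaussFun u γ _ ^ i ≤ _
  rw [gaussFun_C, gaussFun_X_add_C, max_eq_left hc]
  exact term_le_gaussFun u γ f i

lemma gaussFun_taylor (u : Valuation E Γ₀) (γ : Γ₀ˣ) {c : E} (hc : u c ≤ γ) (f : E[X]) :
    gaussFun u γ (taylor c f) = gaussFun u γ f := by
  refine (gaussFun_taylor_le u γ hc f).antisymm ?_
  have h := gaussFun_taylor_le u γ (c := -c) (by rwa [Valuation.map_neg]) (taylor c f)
  rwa [taylor_taylor, neg_add_cancel, taylor_zero] at h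

lemma monomialValuation_algebraMap (u : Valuation E Γ₀) (a : E) (γ : Γ₀ˣ) (f : E[X]) :
    monomialValuation u a γ (algebraMap E[X] (RatFunc E) f) = gaussFun u γ (taylor a f) :=
  Valuation.extendToLocalization_apply_map_apply _ _ _ _

lemma monomialValuation_C (u : Valuation E Γ₀) (a : E) (γ : Γ₀ˣ) (x : E) :
    monomialValuation u a γ (RatFunc.C x) = u x := by
  rw [← RatFunc.algebraMap_C, monomialValuation_algebraMap, taylor_C, gaussFun_C]

lemma monomialValuation_X_sub_C (u : Valuation E Γ₀) (a : E) (γ : Γ₀ˣ) (x : E) :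
    monomialValuation u a γ (RatFunc.X - RatFunc.C x) = max (γ : Γ₀) (u (a - x)) := by
  rw [← RatFunc.algebraMap_C, ← RatFunc.algebraMap_X, ← map_sub, monomialValuation_algebraMap,
    map_sub, taylor_C, taylor_X, add_sub_assoc, ← C_sub, gaussFun_X_add_C]

lemma monomialValuation_comap_C (u : Valuation E Γ₀) (a : E) (γ : Γ₀ˣ) :
    (monomialValuation u a γ).comap RatFunc.C = u :=
  Valuation.ext fun x => monomialValuation_C u a γ x

lemma isPairOfDefinition_monomialValuation (u : Valuation E Γ₀) (a : E) (γ : Γ₀ˣ) :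
    IsPairOfDefinition (monomialValuation u a γ) a γ := by
  rw [IsPairOfDefinition, monomialValuation_comap_C]

lemma valuation_ext_of_algebraMap {W W' : Valuation (RatFunc E) Γ₀}
    (h : ∀ f : E[X], W (algebraMap _ _ f) = W' (algebraMap _ _ f)) : W = W' := by
  refine Valuation.ext fun x => ?_
  rw [← RatFunc.num_div_denom x, map_div₀, map_div₀, h, h]

lemma monomialValuation_congr_center (u : Valuation E Γ₀) {a b : E} {γ : Γ₀ˣ}
    (h : u (a - b) ≤ γ) : monomialValuation u a γ = monomialValuation u b γ := by
  refine valuation_ext_of_algebraMap fun f => ?_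
  rw [monomialValuation_algebraMap, monomialValuation_algebraMap,
    ← gaussFun_taylor u γ h (taylor b f), taylor_taylor, sub_add_cancel]

lemma IsPairOfDefinition.apply_X_sub_C {w : Valuation (RatFunc E) Γ₀} {a : E} {γ : Γ₀ˣ}
    (h : IsPairOfDefinition w a γ) (x : E) :
    w (RatFunc.X - RatFunc.C x) = max (γ : Γ₀) (w (RatFunc.C (a - x))) := by
  conv_lhs => rw [h, monomialValuation_X_sub_C]
  rfl

/-- Computing the values of `X - a` and `X - b` with each of the two pairs gives `δ ≤ γ`, `γ ≤ δ`
and the bound on `a - b`. -/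
lemma IsPairOfDefinition.eq_and_le {w : Valuation (RatFunc E) Γ₀} {a b : E} {γ δ : Γ₀ˣ}
    (h : IsPairOfDefinition w a γ) (h' : IsPairOfDefinition w b δ) :
    γ = δ ∧ w (RatFunc.C (a - b)) ≤ γ := by
  have h1 := h.apply_X_sub_C a
  have h2 := h'.apply_X_sub_C a
  have h3 := h.apply_X_sub_C b
  have h4 := h'.apply_X_sub_C b
  simp only [sub_self, map_zero, max_eq_left zero_le] at h1 h4
  rw [h4] at h3
  rw [h1] at h2
  have hγδ : γ = δ := Units.ext
    (le_antisymm ((le_max_left _ _).trans h3.ge) ((le_max_left _ _).trans h2.ge))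
  exact ⟨hγδ, (le_max_right _ _).trans (h3.ge.trans (by rw [hγδ]))⟩

lemma IsPairOfDefinition.apply_X_sub_C_self {w : Valuation (RatFunc E) Γ₀} {a : E} {γ : Γ₀ˣ}
    (h : IsPairOfDefinition w a γ) : w (RatFunc.X - RatFunc.C a) = γ := by
  rw [h.apply_X_sub_C, sub_self, map_zero, map_zero, max_eq_left zero_le]

/-- The valuation induced on `L(X)` does not depend on the pair of definition. -/
lemma IsInduced.eq_monomialValuation {L : Type*} [Field L] [Algebra E L]
    {w : Valuation (RatFunc E) Γ₀} {u : Valuation L Γ₀} {W : Valuation (RatFunc L) Γ₀}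
    (hW : IsInduced w u W) (huw : ∀ x : E, u (algebraMap E L x) = w (RatFunc.C x))
    {a : E} {γ : Γ₀ˣ} (h : IsPairOfDefinition w a γ) :
    W = monomialValuation u (algebraMap E L a) γ := by
  obtain ⟨b, δ, hb, rfl⟩ := hW
  obtain ⟨rfl, hab⟩ := hb.eq_and_le h
  exact monomialValuation_congr_center u (by rwa [← map_sub, huw])

end Monomial

/-! ### Rational function fields and the consequence of cofinality -/

section Maps

variable {F E : Type*} [Field F] [Field E] [Algebra F E]
  {Γ₀ : Type*} [LinearOrderedCommGroupWithZero Γ₀]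

lemma ratFuncMap_algebraMap (f : F[X]) :
    ratFuncMap F E (algebraMap _ _ f) = algebraMap _ _ (f.map (algebraMap F E)) := by
  have h := RatFunc.map_apply_div (Polynomial.mapRingHom (algebraMap F E))
    (nonZeroDivisors_le_comap_nonZeroDivisors_of_injective _
      (Polynomial.map_injective _ (algebraMap F E).injective)) f 1
  rw [map_one, map_one, map_one, div_one, div_one] at h
  exact h

lemma ratFuncMap_C (x : F) : ratFuncMap F E (RatFunc.C x) = RatFunc.C (algebraMap F E x) := by
  rw [← RatFunc.algebraMap_C, ratFuncMap_algebraMap, map_C, RatFunc.algebraMap_C]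

lemma ratFuncMap_X : ratFuncMap F E RatFunc.X = RatFunc.X := by
  rw [← RatFunc.algebraMap_X, ratFuncMap_algebraMap, map_X, RatFunc.algebraMap_X]

lemma isIntegral_X_sub_C {x : E} (hx : IsIntegral F x) :
    (ratFuncMap F E).IsIntegralElem (RatFunc.X - RatFunc.C x) := by
  refine RingHom.IsIntegralElem.sub _ ?_ ?_
  · rw [← ratFuncMap_X (F := F)]
    exact RingHom.isIntegralElem_map _
  · obtain ⟨p, hp, hpx⟩ := hx
    refine ⟨p.map RatFunc.C, hp.map _, ?_⟩
    rw [eval₂_map]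
    have : (ratFuncMap F E).comp RatFunc.C = (RatFunc.C).comp (algebraMap F E) :=
      RingHom.ext fun y => ratFuncMap_C y
    rw [this, ← hom_eval₂, hpx, map_zero]

/-- If the value group of `F` is cofinal in that of `F(X)`, then the value of `X - a` is
bounded from both sides by values from `F`. -/
lemma exists_bounds_X_sub_C {w : Valuation (RatFunc E) Γ₀}
    (hcof : IsValueCofinal (RatFunc.C (K := F)) (w.comap (ratFuncMap F E))) {a : E} {γ : Γ₀ˣ}
    (ha : IsIntegral F a) (hγ : w (RatFunc.X - RatFunc.C a) = γ) :
    (∃ k : F, k ≠ 0 ∧ w (RatFunc.C (algebraMap F E k)) ≤ γ) ∧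
      ∃ k : F, k ≠ 0 ∧ γ ≤ w (RatFunc.C (algebraMap F E k)) := by
  have hX : RatFunc.X - RatFunc.C a ≠ 0 := w.ne_zero_iff.1 (hγ ▸ γ.ne_zero)
  have hlow : ∀ z : RatFunc F, z ≠ 0 → ∃ k : F, k ≠ 0 ∧
      w (RatFunc.C (algebraMap F E k)) ≤ w (ratFuncMap F E z) := by
    intro z hz
    have hz' : w (ratFuncMap F E z) ≠ 0 := by simpa using hz
    obtain ⟨β, hβ, hβz⟩ := hcof (Units.mk0 _ hz') ((mem_valueGroup_iff_exists _ _).2 ⟨z, rfl⟩)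
    obtain ⟨k, hk⟩ := (mem_valueGroup_iff_exists _ _).1 hβ
    change w (ratFuncMap F E (RatFunc.C k)) = β at hk
    have hβz' : (β : Γ₀) ≤ w (ratFuncMap F E z) := by exact_mod_cast hβz
    refine ⟨k, ?_, ?_⟩
    · rintro rfl
      simp at hk
      exact β.ne_zero hk.symm
    · rwa [← ratFuncMap_C, hk]
  let _ : Algebra (RatFunc F) (RatFunc E) := (ratFuncMap F E).toAlgebra
  have hint : IsIntegral (RatFunc F) (RatFunc.X - RatFunc.C a) := isIntegral_X_sub_C ha
  constructor
  · obtain ⟨z, hz, hzX⟩ := exists_le_valuation_of_isIntegral w hX hint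
    obtain ⟨k, hk, hkz⟩ := hlow z hz
    exact ⟨k, hk, hkz.trans (hzX.trans hγ.le)⟩
  · obtain ⟨z, hz, hzX⟩ := exists_valuation_le_of_isIntegral w hint
    -- Cofinality only provides lower bounds (multiplicatively), so the upper bound is obtained by
    -- inverting.
    obtain ⟨k, hk, hkz⟩ := hlow z⁻¹ (inv_ne_zero hz)
    refine ⟨k⁻¹, inv_ne_zero hk, hγ.ge.trans (hzX.trans ?_)⟩
    rw [map_inv₀, map_inv₀] at hkz
    rw [map_inv₀, map_inv₀, map_inv₀]
    refine le_inv_of_le_inv₀ (zero_lt_iff.2 ?_) hkz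
    simpa using hk

end Maps

end RatFuncValuation

namespace RatFuncValuation

/-! ### Approximation of polynomials over a dense subfield -/

section Density

variable {F H N : Type*} [Field F] [Field H] [Field N] {Γ₀ : Type*}
  [LinearOrderedCommGroupWithZero Γ₀]

/-- The image of `F` is dense in `H`, with respect to the precision given by the values of `F`. -/
def HasDenseImage (i : F →+* H) (v : Valuation H Γ₀) : Prop :=
  ∀ (x : H) (k : F), k ≠ 0 → ∃ y : F, v (x - i y) < v (i k)

/-- An approximation `y` of `x` to precision 1 satisfies `v x ≤ max 1 (v y)`, so 1 or `y` serves.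
The bound `1 ≤ v (i k)` later makes powers monotone in the exponent. -/
lemma HasDenseImage.exists_valuation_le {i : F →+* H} {v : Valuation H Γ₀}
    (h : HasDenseImage i v) (x : H) : ∃ k : F, k ≠ 0 ∧ v x ≤ v (i k) ∧ 1 ≤ v (i k) := by
  obtain ⟨y, hy⟩ := h x 1 one_ne_zero
  rw [map_one, map_one] at hy
  have hx : v x ≤ max 1 (v (i y)) := by
    rw [← sub_add_cancel x (i y)]
    exact (v.map_add _ _).trans (max_le_max_right _ hy.le)
  rcases le_total (v (i y)) 1 with h1 | h1
  · exact ⟨1, one_ne_zero, by simpa [h1] using hx, by simp⟩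
  · refine ⟨y, ?_, by rwa [max_eq_right h1] at hx, h1⟩
    rintro rfl
    simp at h1

lemma HasDenseImage.exists_le_valuation {i : F →+* H} {v : Valuation H Γ₀}
    (h : HasDenseImage i v) {x : H} (hx : x ≠ 0) : ∃ k : F, k ≠ 0 ∧ v (i k) ≤ v x := by
  obtain ⟨k, hk, hkx, -⟩ := h.exists_valuation_le x⁻¹
  refine ⟨k⁻¹, inv_ne_zero hk, ?_⟩
  rw [map_inv₀] at hkx ⊢
  rw [map_inv₀]
  exact inv_le_of_inv_le₀ (zero_lt_iff.2 (v.ne_zero_iff.2 hx)) hkx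

/-- Coefficientwise approximation of polynomials. -/
lemma HasDenseImage.exists_polynomial {i : F →+* H} {v : Valuation H Γ₀}
    (h : HasDenseImage i v) (f : H[X]) {k : F} (hk : k ≠ 0) :
    ∃ g : F[X], g.natDegree ≤ f.natDegree ∧ (f.Monic → g.Monic ∧ g.natDegree = f.natDegree) ∧
      ∀ n, v (f.coeff n - i (g.coeff n)) < v (i k) := by
  have hpos : 0 < v (i k) := zero_lt_iff.2 (by simpa using hk)
  -- The coefficients 0 and 1 are reproduced exactly: 0 keeps the degree from growing, 1 preserves
  -- monicity.
  have hy : ∀ x : H, ∃ y : F, v (x - i y) < v (i k) ∧ (x = 0 → y = 0) ∧ (x = 1 → y = 1) := by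
    intro x
    by_cases h0 : x = 0
    · exact ⟨0, by simpa [h0] using hpos, by simp, by simp [h0]⟩
    by_cases h1 : x = 1
    · exact ⟨1, by simpa [h1] using hpos, by simp [h1], by simp⟩
    obtain ⟨y, hy⟩ := h x k hk
    exact ⟨y, hy, fun h => absurd h h0, fun h => absurd h h1⟩
  choose y hy hy0 hy1 using hy
  set g : F[X] := ∑ n ∈ Finset.range (f.natDegree + 1), monomial n (y (f.coeff n)) with hg
  have hcoeff : ∀ n, g.coeff n = y (f.coeff n) := by
    intro n
    rw [hg, finsetSum_coeff]
    simp only [coeff_monomial, Finset.sum_ite_eq', Finset.mem_range]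
    split_ifs with hn
    · rfl
    · rw [hy0 _ (coeff_eq_zero_of_natDegree_lt (by omega))]
  have hdeg : g.natDegree ≤ f.natDegree := by
    refine natDegree_le_iff_coeff_eq_zero.2 fun n hn => ?_
    rw [hcoeff, hy0 _ (coeff_eq_zero_of_natDegree_lt hn)]
  refine ⟨g, hdeg, fun hf => ?_, fun n => by rw [hcoeff]; exact hy _⟩
  have h1 : g.coeff f.natDegree = 1 := by rw [hcoeff]; exact hy1 _ hf
  exact ⟨monic_of_natDegree_le_of_coeff_eq_one _ hdeg h1,
    natDegree_eq_of_le_of_coeff_ne_zero hdeg (h1 ▸ one_ne_zero)⟩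

/-- Approximation of values of polynomials. -/
lemma HasDenseImage.exists_polynomial_eval₂ {i : F →+* H} (j : H →+* N) (W : Valuation N Γ₀)
    (h : HasDenseImage i (W.comap j)) (f : H[X]) {c : N} {m : F} (hm : W c ≤ W (j (i m)))
    {k : F} (hk : k ≠ 0) :
    ∃ g : F[X], (f.Monic → g.Monic ∧ g.natDegree = f.natDegree) ∧
      W (eval₂ j c f - eval₂ j c (g.map i)) < W (j (i k)) := by
  obtain ⟨m, hm0, hm, hm1⟩ :
      ∃ m : F, m ≠ 0 ∧ W c ≤ W (j (i m)) ∧ 1 ≤ W (j (i m)) := by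
    obtain ⟨m', h1, h2, h3⟩ := h.exists_valuation_le (i m)
    exact ⟨m', h1, hm.trans h2, h3⟩
  -- Powers of `c` up to the degree of `f` have value at most that of `m ^ f.natDegree`, so this
  -- coefficient precision leaves a total error below the value of `k`.
  have hkm : k * (m ^ f.natDegree)⁻¹ ≠ 0 := mul_ne_zero hk (inv_ne_zero (pow_ne_zero _ hm0))
  obtain ⟨g, hgf, hmonic, hg⟩ := h.exists_polynomial f hkm
  refine ⟨g, hmonic, ?_⟩
  have hmpos : 0 < W (j (i m)) ^ f.natDegree := pow_pos (zero_lt_one.trans_le hm1) _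
  rw [← eval₂_sub, eval₂_eq_sum_range' j (n := f.natDegree + 1)
    (Nat.lt_succ_of_le ((natDegree_sub_le _ _).trans (max_le le_rfl (natDegree_map_le.trans hgf))))]
  refine W.map_sum_lt (by simpa using hk) fun n hn => ?_
  rw [coeff_sub, coeff_map, map_mul, map_pow]
  have h1 : W (j (f.coeff n - i (g.coeff n))) < W (j (i k)) * (W (j (i m)) ^ f.natDegree)⁻¹ := by
    simpa using hg n
  have h2 : W c ^ n ≤ W (j (i m)) ^ f.natDegree :=
    (pow_le_pow_left₀ zero_le hm n).trans
      (pow_le_pow_right₀ hm1 (Nat.lt_succ_iff.1 (Finset.mem_range.1 hn)))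
  calc W (j (f.coeff n - i (g.coeff n))) * W c ^ n
      ≤ W (j (f.coeff n - i (g.coeff n))) * W (j (i m)) ^ f.natDegree := by gcongr
    _ < W (j (i k)) * (W (j (i m)) ^ f.natDegree)⁻¹ * W (j (i m)) ^ f.natDegree :=
        mul_lt_mul_of_pos_right h1 hmpos
    _ = W (j (i k)) := by rw [mul_assoc, inv_mul_cancel₀ hmpos.ne', mul_one]

end Density

/-! ### Approximation of algebraic elements and of rational functions -/

section Roots

variable {F H E L : Type*} [Field F] [Field H] [Field E] [Field L] [Algebra F H] [Algebra F E]
  [Algebra F L] [Algebra H L] [Algebra E L] [IsScalarTower F H L] [IsScalarTower F E L]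
  {Γ₀ : Type*} [LinearOrderedCommGroupWithZero Γ₀]

/-- A monic polynomial with a small value at `c` has a root close to `c`. -/
lemma exists_root_valuation_sub_lt [IsAlgClosed E] (u : Valuation L Γ₀) {g : F[X]} (hg : g.Monic)
    {c : L} {t : Γ₀} (h : u (aeval c g) < t ^ g.natDegree) :
    ∃ r : E, aeval r g = 0 ∧ u (c - algebraMap E L r) < t := by
  -- Otherwise all roots are at distance at least `t` from `c`, and the product of these distances,
  -- the value of `g` at `c`, is at least `t ^ g.natDegree`.
  by_contra! hr
  have hs := IsAlgClosed.splits (g.map (algebraMap F E))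
  have hprod := hs.eq_prod_roots_of_monic (hg.map _)
  have hval : aeval c g =
      ((g.map (algebraMap F E)).roots.map fun r => c - algebraMap E L r).prod := by
    rw [← aeval_map_algebraMap E c g]
    conv_lhs => rw [hprod]
    rw [map_multiset_prod, Multiset.map_map]
    congr 1
    refine Multiset.map_congr rfl fun r _ => ?_
    simp
  refine h.not_ge ?_
  rw [hval, map_multiset_prod, Multiset.map_map, ← natDegree_map (algebraMap F E),
    hs.natDegree_eq_card_roots,
    ← Multiset.card_map (fun r => u (c - algebraMap E L r)) (g.map (algebraMap F E)).roots]
  refine Multiset.pow_card_le_prod fun x hx => ?_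
  obtain ⟨r, hrm, rfl⟩ := Multiset.mem_map.1 hx
  refine hr r ?_
  rw [← eval_map_algebraMap]
  exact (mem_roots'.1 hrm).2

/-- Every element of `L` is approximated by elements of `E` of at most the same degree. -/
lemma exists_finrank_le_and_valuation_sub_lt [IsAlgClosed E] (u : Valuation L Γ₀)
    (hd : HasDenseImage (algebraMap F H) (u.comap (algebraMap H L))) {c : L} (hc : IsIntegral H c)
    {k : F} (hk : k ≠ 0) :
    ∃ r : E, Module.finrank F F⟮r⟯ ≤ Module.finrank H H⟮c⟯ ∧
      u (c - algebraMap E L r) < u (algebraMap F L k) := by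
  obtain ⟨m, -, hm⟩ := exists_valuation_le_of_isIntegral u hc
  obtain ⟨m', -, hm', -⟩ := hd.exists_valuation_le m
  -- The precision is the power of `k` needed to force a root of `g` at distance less than the value
  -- of `k`.
  obtain ⟨g, hg, hgc⟩ := hd.exists_polynomial_eval₂ (algebraMap H L) u (minpoly H c)
    (hm.trans hm') (pow_ne_zero (minpoly H c).natDegree hk)
  obtain ⟨hgm, hgd⟩ := hg (minpoly.monic hc)
  rw [← aeval_def, ← aeval_def, minpoly.aeval, zero_sub, Valuation.map_neg,
    aeval_map_algebraMap, ← IsScalarTower.algebraMap_apply, map_pow, map_pow, ← hgd] at hgc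
  obtain ⟨r, hr, hrc⟩ := exists_root_valuation_sub_lt (E := E) u hgm hgc
  refine ⟨r, ?_, hrc⟩
  have hri : IsIntegral F r := ⟨g, hgm, hr⟩
  rw [adjoin.finrank hri, adjoin.finrank hc, ← hgd]
  exact natDegree_le_of_dvd (minpoly.dvd F r hr) hgm.ne_zero

/-- The minimal polynomial over `F` still annihilates the element over `H`. -/
lemma finrank_adjoin_algebraMap_le {a : E} (ha : IsIntegral F a) :
    Module.finrank H H⟮algebraMap E L a⟯ ≤ Module.finrank F F⟮a⟯ := by
  have h0 : aeval (algebraMap E L a) ((minpoly F a).map (algebraMap F H)) = 0 := by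
    rw [aeval_map_algebraMap, aeval_algebraMap_apply, minpoly.aeval, map_zero]
  have hm := (minpoly.monic ha).map (algebraMap F H)
  rw [adjoin.finrank ⟨_, hm, h0⟩, adjoin.finrank ha, ← natDegree_map (algebraMap F H)]
  exact natDegree_le_of_dvd (minpoly.dvd H _ h0) hm.ne_zero

/-- If `γ` is bounded from both sides by values from `F`, then `H(X)` is an immediate extension
of `F(X)` with respect to `u_{a,γ}`. -/
lemma isImmediate_monomialValuation (u : Valuation L Γ₀)
    (hd : HasDenseImage (algebraMap F H) (u.comap (algebraMap H L))) {a : L} (ha : IsIntegral H a)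
    {γ : Γ₀ˣ} {k m : F} (hk : k ≠ 0) (hkγ : u (algebraMap F L k) ≤ γ)
    (hm : γ ≤ u (algebraMap F L m)) :
    IsImmediate (ratFuncMap F H) ((monomialValuation u a γ).comap (ratFuncMap H L)) := by
  set V := (monomialValuation u a γ).comap (ratFuncMap H L) with hV
  have hVC : V.comap RatFunc.C = u.comap (algebraMap H L) := by
    refine Valuation.ext fun x => ?_
    change monomialValuation u a γ (ratFuncMap H L (RatFunc.C x)) = _
    rw [ratFuncMap_C, monomialValuation_C]
    rfl
  have hVC' : ∀ x, V (RatFunc.C x) = u (algebraMap H L x) := fun x =>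
    congrArg (fun v : Valuation H Γ₀ => v x) hVC
  obtain ⟨n, hn⟩ : ∃ n : F, V RatFunc.X ≤ V (RatFunc.C (algebraMap F H n)) := by
    have hX : V RatFunc.X = max (γ : Γ₀) (u a) := by
      have := monomialValuation_X_sub_C u a γ 0
      rw [map_zero, sub_zero, sub_zero] at this
      rw [← this, hV, Valuation.comap_apply, ratFuncMap_X]
    rw [hX]
    rcases le_total (u a) γ with h | h
    · refine ⟨m, ?_⟩
      rw [max_eq_left h, hVC', ← IsScalarTower.algebraMap_apply]
      exact hm
    · obtain ⟨m₁, -, h1⟩ := exists_valuation_le_of_isIntegral u ha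
      obtain ⟨m₂, -, h2, -⟩ := hd.exists_valuation_le m₁
      refine ⟨m₂, ?_⟩
      rw [max_eq_right h, hVC']
      exact h1.trans h2
  have hlow : ∀ f : H[X], f ≠ 0 →
      ∃ s : F, s ≠ 0 ∧ V (RatFunc.C (algebraMap F H s)) ≤ V (algebraMap _ _ f) := by
    intro f hf
    obtain ⟨s, hs, hsf⟩ := hd.exists_le_valuation (leadingCoeff_ne_zero.2 hf)
    -- Recentring at `a` leaves the leading coefficient unchanged, so the top Taylor term alone
    -- provides this lower bound.
    refine ⟨s * k ^ f.natDegree, mul_ne_zero hs (pow_ne_zero _ hk), ?_⟩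
    rw [hVC', ← IsScalarTower.algebraMap_apply, map_mul, map_mul, map_pow, map_pow, hV,
      Valuation.comap_apply, ratFuncMap_algebraMap, monomialValuation_algebraMap]
    refine le_trans ?_ (term_le_gaussFun u γ _ f.natDegree)
    have hc : (taylor a (f.map (algebraMap H L))).coeff f.natDegree =
        algebraMap H L f.leadingCoeff := by
      conv_lhs => rw [← natDegree_map (algebraMap H L), ← natDegree_taylor _ a]
      rw [coeff_natDegree, leadingCoeff_taylor, leadingCoeff_map]
    rw [hc]
    refine mul_le_mul' ?_ (pow_le_pow_left₀ zero_le hkγ _)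
    rw [IsScalarTower.algebraMap_apply F H L]
    exact hsf
  have heval : ∀ f : H[X], eval₂ RatFunc.C RatFunc.X f = algebraMap H[X] (RatFunc H) f := by
    intro f
    have h : (RatFunc.C : H →+* RatFunc H) = (algebraMap H[X] (RatFunc H)).comp C :=
      RingHom.ext fun x => (RatFunc.algebraMap_C x).symm
    rw [h, ← RatFunc.algebraMap_X, ← hom_eval₂, eval₂_C_X]
  have hpoly : ∀ f : H[X], f ≠ 0 → ∃ g : F[X],
      V (algebraMap _ _ f - ratFuncMap F H (algebraMap _ _ g)) < V (algebraMap _ _ f) := by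
    intro f hf
    obtain ⟨s, hs, hsf⟩ := hlow f hf
    obtain ⟨g, -, hg⟩ := (hVC ▸ hd).exists_polynomial_eval₂ RatFunc.C V f hn hs
    refine ⟨g, ?_⟩
    rw [heval, heval] at hg
    rw [ratFuncMap_algebraMap]
    exact hg.trans_le hsf
  refine isImmediate_of_exists_sub_lt _ _ fun x hx => ?_
  have hq0 : algebraMap H[X] (RatFunc H) x.denom ≠ 0 := RatFunc.algebraMap_ne_zero x.denom_ne_zero
  have hp0 : algebraMap H[X] (RatFunc H) x.num ≠ 0 :=
    RatFunc.algebraMap_ne_zero (RatFunc.num_ne_zero hx)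
  obtain ⟨p', hp'⟩ := hpoly x.num (RatFunc.num_ne_zero hx)
  obtain ⟨q', hq'⟩ := hpoly x.denom x.denom_ne_zero
  refine ⟨algebraMap _ _ p' / algebraMap _ _ q', ?_⟩
  have hxpq := RatFunc.num_div_denom x
  rw [map_div₀]
  set p := algebraMap H[X] (RatFunc H) x.num
  set q := algebraMap H[X] (RatFunc H) x.denom
  set P := ratFuncMap F H (algebraMap _ _ p')
  set Q := ratFuncMap F H (algebraMap _ _ q')
  have hQ : V Q = V q := by
    rw [Valuation.map_sub_swap] at hq'
    exact Valuation.map_eq_of_sub_lt _ hq'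
  have hQ0 : Q ≠ 0 := V.ne_zero_iff.1 (hQ ▸ V.ne_zero_iff.2 hq0)
  have hpos : ∀ {z}, z ≠ 0 → 0 < V z := fun hz => zero_lt_iff.2 (V.ne_zero_iff.2 hz)
  -- Both terms of this numerator are smaller in value than `p * q`, and `Q` has the same value as
  -- `q`.
  have hsub : p / q - P / Q = ((p - P) * q - p * (q - Q)) / (q * Q) := by
    field_simp
    ring
  rw [← hxpq, hsub, map_div₀, map_div₀, div_lt_iff₀ (hpos (mul_ne_zero hq0 hQ0)), map_mul, hQ,
    ← mul_assoc, div_mul_cancel₀ _ (V.ne_zero_iff.2 hq0)]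
  refine V.map_sub_lt ?_ ?_
  · rw [map_mul]
    exact mul_lt_mul_of_pos_right hp' (hpos hq0)
  · rw [map_mul]
    exact mul_lt_mul_of_pos_left hq' (hpos hp0)

end Roots

/-! ### Density in the completion, and the theorem -/

lemma hasDenseImage_completion {Γ₀ : Type*} [LinearOrderedCommGroupWithZero Γ₀]
    {K : Type*} [Field K] [Valued K Γ₀] :
    HasDenseImage (algebraMap K (UniformSpace.Completion K))
      (Valued.v : Valuation (UniformSpace.Completion K) Γ₀) := by
  intro x k hk
  have hk' : (Valued.v : Valuation (UniformSpace.Completion K) Γ₀).restrict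
      (algebraMap K (UniformSpace.Completion K) k) ≠ 0 := by
    rw [Valuation.ne_zero_iff]
    simpa using hk
  have hmem : {y : UniformSpace.Completion K | Valued.v (y - x) <
      Valued.v (algebraMap K (UniformSpace.Completion K) k)} ∈ nhds x := by
    -- The radius of a basic neighbourhood must be a unit in the codomain of the restricted
    -- valuation, which is why `hk'` is stated for it.
    refine Valued.mem_nhds.2 ⟨Units.mk0 _ hk', fun y hy => ?_⟩
    exact (Valuation.restrict_lt_iff _).1 hy
  obtain ⟨_, hy, y, rfl⟩ := mem_closure_iff_nhds.1
    (UniformSpace.Completion.denseRange_coe (α := K) x) _ hmem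
  refine ⟨y, ?_⟩
  rw [Valuation.map_sub_swap]
  exact hy

end RatFuncValuation

theorem corollary3p2 {Γ₀ : Type*} [LinearOrderedCommGroupWithZero Γ₀]
    {K : Type*} [Field K] [Valued K Γ₀]
    {Kbar : Type*} [Field Kbar] [Algebra K Kbar] [IsAlgClosure K Kbar]
    {L : Type*} [Field L] [Algebra (UniformSpace.Completion K) L]
    [IsAlgClosure (UniformSpace.Completion K) L]
    [Algebra K L] [IsScalarTower K (UniformSpace.Completion K) L]
    [Algebra Kbar L] [IsScalarTower K Kbar L]
    (w : Valuation (RatFunc Kbar) Γ₀)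
    (hw : ∀ x : K, w (RatFunc.C (algebraMap K Kbar x)) = Valued.v x)
    (hvt : RatFuncValuation.IsValuationTranscendental K
      (w.comap (RatFuncValuation.ratFuncMap K Kbar)))
    (hcof : RatFuncValuation.IsValueCofinal (RatFunc.C (K := K))
      (w.comap (RatFuncValuation.ratFuncMap K Kbar)))
    (u : Valuation L Γ₀)
    (huv : ∀ x : UniformSpace.Completion K,
      u (algebraMap (UniformSpace.Completion K) L x) = Valued.v x)
    (huw : ∀ x : Kbar, u (algebraMap Kbar L x) = w (RatFunc.C x))
    (W : Valuation (RatFunc L) Γ₀) (hW : RatFuncValuation.IsInduced w u W)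
    (a : Kbar) (γ : Γ₀ˣ) (hmin : RatFuncValuation.IsMinimalPairOfDefinition K w a γ) :
    RatFuncValuation.IsMinimalPairOfDefinition (UniformSpace.Completion K) W
        (algebraMap Kbar L a) γ ∧
      Module.finrank K (IntermediateField.adjoin K {a}) =
        Module.finrank (UniformSpace.Completion K)
          (IntermediateField.adjoin (UniformSpace.Completion K) {algebraMap Kbar L a}) ∧
      RatFuncValuation.IsImmediate
        (RatFuncValuation.ratFuncMap K (UniformSpace.Completion K))
        (W.comap (RatFuncValuation.ratFuncMap (UniformSpace.Completion K) L)) := by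
  have := IsAlgClosure.isAlgClosed (R := K) (K := Kbar)
  have hint : ∀ x : Kbar, IsIntegral K x := fun x =>
    (IsAlgClosure.isAlgebraic (R := K) (K := Kbar)).isIntegral.isIntegral x
  have hint' : ∀ x : L, IsIntegral (UniformSpace.Completion K) x := fun x =>
    (IsAlgClosure.isAlgebraic (R := UniformSpace.Completion K) (K := L)).isIntegral.isIntegral x
  obtain ⟨hpair, hmin⟩ := hmin
  obtain rfl := hW.eq_monomialValuation huw hpair
  have hd : RatFuncValuation.HasDenseImage (algebraMap K (UniformSpace.Completion K))
      (u.comap (algebraMap (UniformSpace.Completion K) L)) := by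
    rw [show u.comap (algebraMap (UniformSpace.Completion K) L) = Valued.v from
      Valuation.ext huv]
    exact RatFuncValuation.hasDenseImage_completion
  have hK : ∀ k : K, u (algebraMap K L k) = w (RatFunc.C (algebraMap K Kbar k)) := fun k => by
    rw [IsScalarTower.algebraMap_apply K Kbar L, huw]
  obtain ⟨⟨k, hk, hkγ⟩, m, -, hm⟩ := RatFuncValuation.exists_bounds_X_sub_C hcof (hint a)
    hpair.apply_X_sub_C_self
  rw [← hK] at hkγ hm
  have hle : ∀ c : L, u (algebraMap Kbar L a - c) ≤ γ →
      Module.finrank K (IntermediateField.adjoin K {a}) ≤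
        Module.finrank (UniformSpace.Completion K)
          (IntermediateField.adjoin (UniformSpace.Completion K) {c}) := by
    intro c hc
    -- Since the value of `k` is at most `γ`, the approximation `r` of `c` remains within `γ` of
    -- `a`, where minimality over `K` applies.
    obtain ⟨r, hr, hcr⟩ := RatFuncValuation.exists_finrank_le_and_valuation_sub_lt (E := Kbar) u hd
      (hint' c) hk
    refine (hmin r ?_).trans hr
    rw [← huw, map_sub, ← sub_add_sub_cancel _ c]
    exact (u.map_add _ _).trans (max_le hc (hcr.le.trans hkγ))
  -- The case `c = a`, where the difference is 0.
  have heq := (hle (algebraMap Kbar L a) (by simp)).antisymm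
    (RatFuncValuation.finrank_adjoin_algebraMap_le (H := UniformSpace.Completion K) (L := L)
      (hint a))
  refine ⟨⟨RatFuncValuation.isPairOfDefinition_monomialValuation _ _ _, fun c hc => ?_⟩, heq,
    RatFuncValuation.isImmediate_monomialValuation u hd (hint' _) hk hkγ hm⟩
  rw [RatFuncValuation.monomialValuation_C] at hc
  exact heq ▸ hle c hc
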